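/- Let $n\ge 1$, let $\mathbb{D}=\{z\in\mathbb{C}:|z|<1\}$, and let $z_1,\ldots,z_n\in\partial\mathbb{D}$ be distinct. There are Blaschke products $$B(z)=\chi\prod_{k=1}^n\frac{z-a_k}{1-\overline{a_k}\,z},\qquad |\chi|=1,\quad a_1,\ldots,a_n\in\mathbb{D},$$ of degree $n$ with $B(z_j)=1$ for $j=1,\ldots,n$ and $B'(0)\ne 0$. For every such $B$ there exist $\zeta_1,\ldots,\zeta_{n-1}\in\mathbb{D}\setminus\{0\}$ such that, with $\zeta^*:=1/\overline{\zeta}$, the (doubled) energy $$W(w_1,\ldots,w_n):=\sum_{k=1}^{n-1}\sum_{j=1}^n\log|(w_j-\zeta_k)(w_j-\zeta_k^*)|-2\sum_{1\le j<k\le n}\log|w_j-w_k|$$ has a critical point at $(w_1,\ldots,w_n)=(z_1,\ldots,z_n)$, even regarded as a point of $\mathbb{C}^n$: $W$ is real differentiable there as a function on $\mathbb{C}^n=\mathbb{R}^{2n}$, and its derivative is zero. Moreover, the restriction of $W$ to $(\partial\mathbb{D})^n$ (with $W=+\infty$ where two of the $w_j$ coincide) attains its global minimum at $(z_1,\ldots,z_n)$.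 -/

import Mathlib

noncomputable section

/-- The Blaschke product `χ ∏ₖ (z - aₖ) / (1 - conj aₖ z)` of degree `n`, with zeros `a₁, …, aₙ`
(meant for `|aₖ| < 1`) and leading coefficient `χ` (meant for `|χ| = 1`). -/
def blaschke {n : ℕ} (χ : ℂ) (a : Fin n → ℂ) (z : ℂ) : ℂ :=
  χ * ∏ k, (z - a k) / (1 - (starRingEnd ℂ) (a k) * z)

/-- `χ` and `a₁, …, aₙ` are the data of a Blaschke product of degree `n` that takes the value `1` at
all the points `z₁, …, zₙ` and whose derivative does not vanish at the origin. -/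
def IsInterpolatingBlaschke {n : ℕ} (z : Fin n → ℂ) (χ : ℂ) (a : Fin n → ℂ) : Prop :=
  ‖χ‖ = 1 ∧ (∀ k, ‖a k‖ < 1) ∧ (∀ j, blaschke χ a (z j) = 1) ∧ deriv (blaschke χ a) 0 ≠ 0

/-- Reflection in the unit circle, `ζ* = 1 / conj ζ`. -/
def circleReflection (ζ : ℂ) : ℂ := 1 / (starRingEnd ℂ) ζ

/-- The doubled discrete energy of electrons at `w₁, …, wₙ` in the field of the pairs of protons
`ζₖ, ζₖ*`, as a real number. It is the energy wherever that is finite, that is, if the `wⱼ` are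
distinct and no `wⱼ` is a `ζₖ` or a `ζₖ*`. -/
def energy {n m : ℕ} (ζ : Fin m → ℂ) (w : Fin n → ℂ) : ℝ :=
  (∑ k, ∑ j, Real.log ‖(w j - ζ k) * (w j - circleReflection (ζ k))‖)
    - 2 * ∑ j, ∑ k ∈ Finset.Ioi j, Real.log ‖w j - w k‖

open scoped Classical in
/-- The energy of electrons that do not meet the protons, with its value `+∞` when two electrons
coincide (`-log 0 = +∞`). On the product of unit circles the electrons never meet protons with
`0 < |ζₖ| < 1`, so there this is the energy with all its values. -/
def energyExt {n m : ℕ} (ζ : Fin m → ℂ) (w : Fin n → ℂ) : EReal :=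
  if Function.Injective w then (energy ζ w : EReal) else ⊤

end

/-!
Write `B = P / Q` with `P = χ ∏ (z - aₖ)` and `Q = ∏ (1 - conj aₖ z)`, and let `S = P' Q - P Q'` be
the numerator of `B'`. Since `P - Q` is a multiple of `∏ (z - zⱼ)`, Lagrange interpolation of `Q` at
the points `zⱼ` gives the identity `S = ∑ S(zⱼ) Lⱼ²`, where the `Lⱼ` are the Lagrange basis polynomials
(`wronskian_eq_sum`). On the unit circle `w B'(w) / B(w) > 0`, so that `S(w)` is nonzero with the
argument of `χ w ^ (n - 1)` (`eval_blaschkeCritical_of_norm_eq_one`). Three consequences follow.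

* The `2n - 2` zeros of `S` are symmetric in the unit circle and none lies on it; as
  `S(0) = B'(0) ≠ 0`, they are pairs `ζₖ`, `ζₖ*` with `0 < |ζₖ| < 1` (`exists_eq_prod_pairs`). These
  are the protons.
* By the identity `S'(zⱼ) / S(zⱼ) = 2 Lⱼ'(zⱼ) = 2 ∑_{k ≠ j} 1 / (zⱼ - zₖ)`, which says that the forces
  on each electron cancel (`hasFDerivAt_energy`).
* The identity also holds for absolute values: `|S(w)| = ∑ |S(zⱼ)| |Lⱼ(w)|²` for `|w| = 1`. Hence
  Hadamard's inequality for the matrix `√|S(zⱼ)| Lⱼ(wᵢ)`, whose determinant is a quotient of Vandermonde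
  determinants, reads `∏ |S(zⱼ)| |V(w)|² ≤ ∏ |S(wᵢ)| |V(z)|²` (`prod_mul_vandermonde_le`). The
  logarithm of `∏ |S(wⱼ)| / |V(w)|²` is the energy up to a constant, and so it is minimal at `z`.

In other words, the reproducing kernel of the model space of `B` is diagonal on a fibre of `B`, which
is the case of equality in Hadamard's inequality.

For the existence of `B`, weights `tⱼ > 0` define `F = ∑ tⱼ (z + zⱼ) / (z - zⱼ)`, whose real part is
negative in the disc and nonnegative off it, and `B` is a unimodular multiple of `(F + 1) / (F - 1)`,
with poles of `F` where `B` takes one and the same unimodular value.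
-/

noncomputable section

open Polynomial
open scoped ComplexConjugate

/-! ### Hadamard's inequality -/

open scoped ComplexOrder in
/-- Hadamard's inequality for rows of unit length: the eigenvalues of `M * Mᴴ` are nonnegative and
add up to the size of `M`, so their product is at most `1` by the inequality of arithmetic and
geometric means. -/
theorem norm_det_sq_le_one_of_row_norm {ι : Type*} [Fintype ι] [DecidableEq ι]
    (M : Matrix ι ι ℂ) (hM : ∀ i, ∑ j, ‖M i j‖ ^ 2 = 1) : ‖M.det‖ ^ 2 ≤ 1 := by
  rcases isEmpty_or_nonempty ι with hι | hι
  · simp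
  have hA := Matrix.posSemidef_self_mul_conjTranspose M
  have hdet : (‖M.det‖ ^ 2 : ℝ) = ∏ i, hA.1.eigenvalues i := by
    have h1 : (M * M.conjTranspose).det = ∏ i, ((hA.1.eigenvalues i : ℝ) : ℂ) :=
      hA.1.det_eq_prod_eigenvalues
    rw [Matrix.det_mul, Matrix.det_conjTranspose] at h1
    have h2 : M.det * star M.det = ((‖M.det‖ ^ 2 : ℝ) : ℂ) := by
      rw [Complex.ofReal_pow]; exact Complex.mul_conj' _
    rw [h2] at h1
    exact_mod_cast h1
  have htr : ∑ i, hA.1.eigenvalues i = Fintype.card ι := by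
    have h1 : (M * M.conjTranspose).trace = ∑ i, ((hA.1.eigenvalues i : ℝ) : ℂ) :=
      hA.1.trace_eq_sum_eigenvalues
    have h2 : (M * M.conjTranspose).trace = ((Fintype.card ι : ℝ) : ℂ) := by
      have h3 : ∀ i, (M * M.conjTranspose) i i = 1 := by
        intro i
        rw [Matrix.mul_apply]
        have : ∀ j, M i j * M.conjTranspose j i = ((‖M i j‖ ^ 2 : ℝ) : ℂ) := by
          intro j
          rw [Complex.ofReal_pow, Matrix.conjTranspose_apply]; exact Complex.mul_conj' _
        simp_rw [this]
        rw [← Complex.ofReal_sum, hM i, Complex.ofReal_one]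
      simp [Matrix.trace, h3]
    rw [h2] at h1
    exact_mod_cast h1.symm
  have hpos : (0 : ℝ) < Fintype.card ι := by exact_mod_cast Fintype.card_pos
  have := Real.geom_mean_le_arith_mean Finset.univ (fun _ => 1) hA.1.eigenvalues (by simp)
    (by simpa using Fintype.card_pos) (fun i _ => hA.eigenvalues_nonneg i)
  simp only [Real.rpow_one, one_mul, Finset.sum_const, Finset.card_univ, nsmul_eq_mul, mul_one,
    htr, ← hdet] at this
  rw [div_self hpos.ne'] at this
  by_contra! hlt
  exact absurd this (not_le.mpr (Real.one_lt_rpow hlt (inv_pos.mpr hpos)))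

/-- **Hadamard's inequality.** -/
theorem norm_det_sq_le_prod_row_norm {ι : Type*} [Fintype ι] [DecidableEq ι]
    (M : Matrix ι ι ℂ) : ‖M.det‖ ^ 2 ≤ ∏ i, ∑ j, ‖M i j‖ ^ 2 := by
  have hnn : ∀ i, 0 ≤ ∑ j, ‖M i j‖ ^ 2 := fun i => Finset.sum_nonneg fun j _ => by positivity
  by_cases h0 : ∃ i, ∑ j, ‖M i j‖ ^ 2 = 0
  · obtain ⟨i, hi⟩ := h0
    have hrow : ∀ j, M i j = 0 := by
      intro j
      have := (Finset.sum_eq_zero_iff_of_nonneg (fun j _ => by positivity)).mp hi j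
        (Finset.mem_univ j)
      simpa using this
    rw [Matrix.det_eq_zero_of_row_eq_zero i hrow]
    simpa using Finset.prod_nonneg fun i _ => hnn i
  push Not at h0
  -- The general case reduces to rows of unit length by dividing each row by its length `r i`.
  set r : ι → ℝ := fun i => √(∑ j, ‖M i j‖ ^ 2) with hr
  have hrpos : ∀ i, 0 < r i := fun i => Real.sqrt_pos.mpr (lt_of_le_of_ne (hnn i) (h0 i).symm)
  have hrsq : ∀ i, r i ^ 2 = ∑ j, ‖M i j‖ ^ 2 := fun i => Real.sq_sqrt (hnn i)
  have key := norm_det_sq_le_one_of_row_norm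
    (Matrix.of fun i j => ((r i)⁻¹ : ℂ) * M i j) (by
      intro i
      simp only [Matrix.of_apply, norm_mul, mul_pow, ← Finset.mul_sum, ← hrsq, norm_inv,
        Complex.norm_real, Real.norm_of_nonneg (hrpos i).le]
      have := (hrpos i).ne'
      field_simp)
  rw [Matrix.det_mul_column, norm_mul, mul_pow, norm_prod] at key
  simp only [norm_inv, Complex.norm_real, Real.norm_of_nonneg (hrpos _).le, Finset.prod_inv_distrib,
    inv_pow] at key
  simp_rw [← hrsq, Finset.prod_pow]
  have hP : 0 < (∏ i, r i) ^ 2 := pow_pos (Finset.prod_pos fun i _ => hrpos i) 2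
  rwa [inv_mul_le_iff₀ hP, mul_one] at key

/-! ### Lagrange interpolation and Wronskians -/

section Lagrange

variable {K : Type*} [Field K] {ι : Type*} [Fintype ι] [DecidableEq ι]

/-- The Lagrange basis polynomial of the node `z j` among all the nodes `z`. -/
abbrev lagrangeBasis (z : ι → K) (j : ι) : K[X] := Lagrange.basis Finset.univ z j

/-- The monic polynomial with simple zeros at the nodes. -/
abbrev nodePoly (z : ι → K) : K[X] := Lagrange.nodal Finset.univ z

theorem eval_lagrangeBasis_node {z : ι → K} (hz : Function.Injective z) (i j : ι) :
    (lagrangeBasis z i).eval (z j) = if i = j then 1 else 0 := by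
  split_ifs with h
  · subst h; exact Lagrange.eval_basis_self hz.injOn (Finset.mem_univ _)
  · exact Lagrange.eval_basis_of_ne h (Finset.mem_univ _)

theorem eval_derivative_nodePoly_ne_zero {z : ι → K} (hz : Function.Injective z) (j : ι) :
    (derivative (nodePoly z)).eval (z j) ≠ 0 := by
  rw [Ne, ← inv_eq_zero, ← Lagrange.nodalWeight_eq_eval_derivative_nodal (Finset.mem_univ j)]
  exact Lagrange.nodalWeight_ne_zero hz.injOn (Finset.mem_univ j)

theorem eval_derivative_nodePoly (z : ι → K) (j : ι) :
    (derivative (nodePoly z)).eval (z j) = ∏ k ∈ Finset.univ.erase j, (z j - z k) := by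
  rw [Lagrange.eval_nodal_derivative_eval_node_eq (Finset.mem_univ j), Lagrange.eval_nodal]

theorem eval_lagrangeBasis (z : ι → K) (j : ι) (x : K) :
    (lagrangeBasis z j).eval x = ∏ k ∈ Finset.univ.erase j, ((x - z k) / (z j - z k)) := by
  simp [lagrangeBasis, Lagrange.basis, Lagrange.basisDivisor, eval_prod, div_eq_inv_mul]

theorem nodePoly_eq_mul_lagrangeBasis {z : ι → K} (hz : Function.Injective z) (j : ι) :
    nodePoly z = C ((derivative (nodePoly z)).eval (z j)) * ((X - C (z j)) * lagrangeBasis z j) := by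
  have h : lagrangeBasis z j = C ((derivative (nodePoly z)).eval (z j))⁻¹ *
      Lagrange.nodal (Finset.univ.erase j) z := by
    rw [← Lagrange.nodalWeight_eq_eval_derivative_nodal (Finset.mem_univ j), Lagrange.nodalWeight,
      map_prod, Lagrange.nodal, ← Finset.prod_mul_distrib]
    rfl
  rw [h, mul_left_comm (X - C _), ← mul_assoc, ← C_mul,
    mul_inv_cancel₀ (eval_derivative_nodePoly_ne_zero hz j), C_1, one_mul]
  exact Lagrange.nodal_eq_mul_nodal_erase (Finset.mem_univ j)

/-- Up to a constant, the node polynomial is `(X - zⱼ)` times the `j`-th Lagrange basis polynomial, so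
the Wronskian of the two is the derivative of `X - zⱼ` times a square. -/
theorem wronskian_lagrangeBasis_nodePoly {z : ι → K} (hz : Function.Injective z) (j : ι) :
    wronskian (lagrangeBasis z j) (nodePoly z) =
      C ((derivative (nodePoly z)).eval (z j)) * lagrangeBasis z j ^ 2 := by
  have h := nodePoly_eq_mul_lagrangeBasis hz j
  generalize eval (z j) _ = c at h ⊢
  rw [h]
  simp only [wronskian, derivative_mul, derivative_C, derivative_sub, derivative_X]
  ring

/-- A polynomial of degree at most the number of nodes is its interpolation polynomial plus a multiple
of the node polynomial. -/
theorem eq_nodePoly_add_interpolation {z : ι → K} (hz : Function.Injective z) {f : K[X]}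
    (hf : f.natDegree ≤ Fintype.card ι) :
    f = C (f.coeff (Fintype.card ι)) * nodePoly z + ∑ j, C (f.eval (z j)) * lagrangeBasis z j := by
  have hN : (nodePoly z).natDegree = Fintype.card ι := Lagrange.natDegree_nodal
  have hcoeff : (nodePoly z).coeff (Fintype.card ι) = 1 := by
    rw [← hN]; exact Lagrange.nodal_monic
  have hdeg : (f - C (f.coeff (Fintype.card ι)) * nodePoly z).degree <
      (Finset.univ : Finset ι).card := by
    rw [Finset.card_univ, degree_lt_iff_coeff_zero]
    intro m hm
    rcases hm.eq_or_lt with rfl | hm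
    · simp [hcoeff]
    · rw [coeff_sub, coeff_C_mul, coeff_eq_zero_of_natDegree_lt (hf.trans_lt hm),
        coeff_eq_zero_of_natDegree_lt (hN.le.trans_lt hm)]
      simp
  have h := Lagrange.eq_interpolate hz.injOn hdeg
  rw [Lagrange.interpolate_apply] at h
  rw [← sub_eq_iff_eq_add', h]
  refine Finset.sum_congr rfl fun j _ => ?_
  rw [eval_sub, eval_mul, Lagrange.eval_nodal_at_node (Finset.mem_univ j), mul_zero, sub_zero]

/-- If `P` and `Q` agree at the nodes and have degree at most their number, then the numerator of
`(P / Q)'` is a combination of squares of Lagrange basis polynomials. Indeed `P` may be replaced by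
`P - Q`, a multiple of the node polynomial, and then `Q` by its interpolation polynomial. -/
theorem wronskian_eq_sum {z : ι → K} (hz : Function.Injective z) {P Q : K[X]}
    (hP : P.natDegree ≤ Fintype.card ι) (hQ : Q.natDegree ≤ Fintype.card ι)
    (hPQ : ∀ j, P.eval (z j) = Q.eval (z j)) :
    wronskian Q P = ∑ j, C ((P - Q).coeff (Fintype.card ι) * Q.eval (z j) *
      (derivative (nodePoly z)).eval (z j)) * lagrangeBasis z j ^ 2 := by
  have hR : P = Q + C ((P - Q).coeff (Fintype.card ι)) * nodePoly z := by
    have := eq_nodePoly_add_interpolation hz (f := P - Q) (by simpa using natDegree_sub_le_of_le hP hQ)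
    simp only [eval_sub, hPQ, sub_self, C_0, zero_mul, Finset.sum_const_zero, add_zero] at this
    rw [← this]; ring
  have hQ' := eq_nodePoly_add_interpolation hz hQ
  generalize (P - Q).coeff (Fintype.card ι) = c at hR
  generalize Q.coeff (Fintype.card ι) = d at hQ'
  have h1 : wronskian Q P = wronskian (∑ j, C (Q.eval (z j)) * lagrangeBasis z j)
      (C c * nodePoly z) := by
    have : Q - C d * nodePoly z = ∑ j, C (Q.eval (z j)) * lagrangeBasis z j := by
      rw [sub_eq_iff_eq_add']; exact hQ'
    rw [← this, hR]
    simp only [wronskian, derivative_mul, derivative_C, derivative_add, derivative_sub]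
    ring
  have h2 : ∀ j, C (c * Q.eval (z j) * (derivative (nodePoly z)).eval (z j)) *
      lagrangeBasis z j ^ 2 =
      wronskian (C (Q.eval (z j)) * lagrangeBasis z j) (C c * nodePoly z) := by
    intro j
    rw [C_mul, C_mul, mul_assoc, ← wronskian_lagrangeBasis_nodePoly hz j]
    simp only [wronskian, derivative_mul, derivative_C]
    ring
  rw [h1, Finset.sum_congr rfl fun j _ => h2 j]
  simp only [wronskian, derivative_sum, Finset.sum_mul, Finset.sum_sub_distrib]

theorem eval_sum_sq_lagrangeBasis_node {z : ι → K} (hz : Function.Injective z) (d : ι → K) (j : ι) :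
    (∑ i, C (d i) * lagrangeBasis z i ^ 2).eval (z j) = d j := by
  simp [eval_finsetSum, eval_lagrangeBasis_node hz]

theorem eval_derivative_lagrangeBasis {z : ι → K} (hz : Function.Injective z) (j : ι) :
    (derivative (lagrangeBasis z j)).eval (z j) = ∑ k ∈ Finset.univ.erase j, (z j - z k)⁻¹ := by
  have hne : ∀ k ∈ Finset.univ.erase j, z j - z k ≠ 0 := fun k hk =>
    sub_ne_zero.mpr (hz.ne (Finset.ne_of_mem_erase hk).symm)
  rw [lagrangeBasis, Lagrange.basis, derivative_prod_finset, eval_finsetSum]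
  refine Finset.sum_congr rfl fun k hk => ?_
  rw [eval_mul, eval_prod, Finset.prod_eq_one, one_mul]
  · simp [Lagrange.basisDivisor]
  · intro i hi
    exact Lagrange.eval_basisDivisor_left_of_ne
      (sub_ne_zero.mp (hne i (Finset.mem_of_mem_erase hi)))

/-- At a node, the logarithmic derivative of a combination of squared Lagrange basis polynomials does
not depend on the coefficients: it is `2 ∑ (zⱼ - zₖ)⁻¹`, the force of the other nodes. -/
theorem eval_derivative_sum_sq_lagrangeBasis {z : ι → K} (hz : Function.Injective z) (d : ι → K)
    (j : ι) : (derivative (∑ i, C (d i) * lagrangeBasis z i ^ 2)).eval (z j) =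
      2 * d j * ∑ k ∈ Finset.univ.erase j, (z j - z k)⁻¹ := by
  rw [← eval_derivative_lagrangeBasis hz]
  simp only [derivative_sum, derivative_mul, derivative_C, derivative_pow, eval_finsetSum, eval_mul,
    eval_lagrangeBasis_node hz, eval_C, zero_mul, eval_pow, zero_add]
  rw [Finset.sum_eq_single j]
  · simp; ring
  · intro i _ hij
    simp [hij]
  · simp

/-- Lagrange interpolation of the monomials, written as a product of matrices. -/
theorem det_lagrangeBasis_mul_vandermonde {n : ℕ} {z : Fin n → K} (hz : Function.Injective z)
    (w : Fin n → K) :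
    (Matrix.of fun i j => (lagrangeBasis z j).eval (w i)).det * (Matrix.vandermonde z).det =
      (Matrix.vandermonde w).det := by
  rw [← Matrix.det_mul]
  congr 1
  ext i k
  rw [Matrix.mul_apply]
  simp only [Matrix.of_apply, Matrix.vandermonde_apply]
  have h := Lagrange.eq_interpolate (s := Finset.univ) hz.injOn (f := (X : K[X]) ^ (k : ℕ)) (by
    rw [degree_X_pow, Finset.card_univ, Fintype.card_fin]; exact_mod_cast k.2)
  have h2 := congrArg (eval (w i)) h
  rw [Lagrange.interpolate_apply, eval_finsetSum] at h2
  simp only [eval_mul, eval_pow, eval_X, eval_C] at h2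
  rw [h2]
  exact Finset.sum_congr rfl fun j _ => mul_comm _ _

end Lagrange

/-! ### Blaschke products on the unit circle -/

/-- The logarithmic derivative of a product of polynomials, at a point that is a zero of no factor. -/
theorem eval_derivative_prod_eq_mul_sum {K ι : Type*} [Field K] (s : Finset ι) (f : ι → K[X])
    (x : K) (hf : ∀ i ∈ s, (f i).eval x ≠ 0) :
    (derivative (∏ i ∈ s, f i)).eval x =
      (∏ i ∈ s, f i).eval x * ∑ i ∈ s, (derivative (f i)).eval x / (f i).eval x := by
  classical
  rw [derivative_prod_finset, eval_finsetSum, Finset.mul_sum]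
  refine Finset.sum_congr rfl fun i hi => ?_
  rw [← Finset.prod_erase_mul _ _ hi, eval_mul, eval_mul]
  field_simp [hf i hi]

theorem sq_sub_of_norm_eq_one {w z : ℂ} (hw : ‖w‖ = 1) (hz : ‖z‖ = 1) :
    (w - z) ^ 2 = -(w * z) * (‖w - z‖ : ℂ) ^ 2 := by
  have hw' : w * conj w = 1 := by rw [Complex.mul_conj', hw]; simp
  have hz' : z * conj z = 1 := by rw [Complex.mul_conj', hz]; simp
  rw [← Complex.mul_conj', map_sub]
  linear_combination (-(z * z) + w * z) * hw' + (-(w * w) + w * z) * hz'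

/-- On the unit circle the argument of `Lⱼ(w) ^ 2` is that of `(w / zⱼ) ^ (n - 1)`. This holds for
coinciding nodes too, as `x / 0 = 0` makes both sides vanish. -/
theorem sq_eval_lagrangeBasis_of_norm_eq_one {n : ℕ} {z : Fin n → ℂ} (hz : ∀ j, ‖z j‖ = 1)
    {w : ℂ} (hw : ‖w‖ = 1) (j : Fin n) :
    ((lagrangeBasis z j).eval w) ^ 2 =
      (w / z j) ^ (n - 1) * (‖(lagrangeBasis z j).eval w‖ : ℂ) ^ 2 := by
  have hz0 : ∀ j, z j ≠ 0 := fun j => norm_ne_zero_iff.mp (by rw [hz j]; exact one_ne_zero)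
  have hcard : n - 1 = (Finset.univ.erase j).card := by
    rw [Finset.card_erase_of_mem (Finset.mem_univ j), Finset.card_univ, Fintype.card_fin]
  rw [eval_lagrangeBasis, norm_prod, Complex.ofReal_prod, ← Finset.prod_pow, ← Finset.prod_pow,
    hcard, ← Finset.prod_const, ← Finset.prod_mul_distrib]
  refine Finset.prod_congr rfl fun k _ => ?_
  rw [div_pow, sq_sub_of_norm_eq_one hw (hz k), sq_sub_of_norm_eq_one (hz j) (hz k), norm_div,
    Complex.ofReal_div]
  have h1 := hz0 j
  have h2 := hz0 k
  by_cases hjk : z j = z k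
  · simp [hjk]
  have h3 : (‖z j - z k‖ : ℂ) ≠ 0 := by
    exact_mod_cast norm_ne_zero_iff.mpr (sub_ne_zero.mpr hjk)
  field_simp

variable {n m : ℕ}

/-- The numerator of a Blaschke product. -/
def blaschkeNum (χ : ℂ) (a : Fin n → ℂ) : ℂ[X] := C χ * ∏ k, (X - C (a k))

/-- The denominator of a Blaschke product. -/
def blaschkeDen (a : Fin n → ℂ) : ℂ[X] := ∏ k, (1 - C (conj (a k)) * X)

/-- The numerator `P' Q - P Q'` of the derivative of a Blaschke product `P / Q`; its zeros are the
critical points. Mathlib's `wronskian Q P` is `Q P' - Q' P`. -/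
def blaschkeCritical (χ : ℂ) (a : Fin n → ℂ) : ℂ[X] :=
  wronskian (blaschkeDen a) (blaschkeNum χ a)

theorem eval_blaschkeNum (χ : ℂ) (a : Fin n → ℂ) (z : ℂ) :
    (blaschkeNum χ a).eval z = χ * ∏ k, (z - a k) := by
  simp [blaschkeNum, eval_prod]

theorem eval_blaschkeDen (a : Fin n → ℂ) (z : ℂ) :
    (blaschkeDen a).eval z = ∏ k, (1 - conj (a k) * z) := by
  simp [blaschkeDen, eval_prod]

theorem blaschke_eq_div (χ : ℂ) (a : Fin n → ℂ) (z : ℂ) :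
    blaschke χ a z = (blaschkeNum χ a).eval z / (blaschkeDen a).eval z := by
  rw [eval_blaschkeNum, eval_blaschkeDen, blaschke, Finset.prod_div_distrib, mul_div_assoc]

theorem natDegree_blaschkeNum_le (χ : ℂ) (a : Fin n → ℂ) : (blaschkeNum χ a).natDegree ≤ n := by
  refine (natDegree_C_mul_le _ _).trans ((natDegree_prod_le _ _).trans ?_)
  simp

theorem coeff_blaschkeNum (χ : ℂ) (a : Fin n → ℂ) : (blaschkeNum χ a).coeff n = χ := by
  have hm : (∏ k, (X - C (a k))).Monic := monic_prod_X_sub_C _ _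
  have hd : (∏ k, (X - C (a k))).natDegree = n := by simp
  have hc := hm.coeff_natDegree
  rw [hd] at hc
  rw [blaschkeNum, coeff_C_mul, hc, mul_one]

theorem natDegree_one_sub_C_mul_X_le (b : ℂ) : (1 - C b * X : ℂ[X]).natDegree ≤ 1 := by
  compute_degree

theorem natDegree_blaschkeDen_le (a : Fin n → ℂ) : (blaschkeDen a).natDegree ≤ n := by
  refine (natDegree_prod_le _ _).trans ?_
  refine (Finset.sum_le_sum fun k _ => natDegree_one_sub_C_mul_X_le _).trans ?_
  simp

theorem coeff_blaschkeDen (a : Fin n → ℂ) : (blaschkeDen a).coeff n = ∏ k, -conj (a k) := by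
  have h := coeff_prod_of_natDegree_le (s := Finset.univ) (fun k => 1 - C (conj (a k)) * X) 1
    (fun k _ => natDegree_one_sub_C_mul_X_le _)
  simpa [blaschkeDen, coeff_one] using h

theorem eval_blaschkeDen_ne_zero {a : Fin n → ℂ} (ha : ∀ k, ‖a k‖ < 1) {z : ℂ} (hz : ‖z‖ ≤ 1) :
    (blaschkeDen a).eval z ≠ 0 := by
  rw [eval_blaschkeDen, Finset.prod_ne_zero_iff]
  intro k _ h
  have h1 : ‖conj (a k) * z‖ = 1 := by rw [← sub_eq_zero.mp h, norm_one]
  rw [norm_mul, RCLike.norm_conj] at h1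
  nlinarith [ha k, norm_nonneg (a k), norm_nonneg z]

theorem deriv_blaschke_zero (χ : ℂ) (a : Fin n → ℂ) :
    deriv (blaschke χ a) 0 = (blaschkeCritical χ a).eval 0 := by
  have h1 : (blaschkeDen a).eval 0 = 1 := by simp [eval_blaschkeDen]
  rw [funext (blaschke_eq_div χ a), deriv_fun_div (Polynomial.differentiableAt _)
    (Polynomial.differentiableAt _) (by rw [h1]; exact one_ne_zero)]
  simp only [Polynomial.deriv, h1, blaschkeCritical, wronskian, eval_sub, eval_mul]
  ring

theorem eval_blaschkeNum_of_norm_eq_one (χ : ℂ) (a : Fin n → ℂ) {w : ℂ} (hw : ‖w‖ = 1) :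
    (blaschkeNum χ a).eval w = χ * w ^ n * conj ((blaschkeDen a).eval w) := by
  have hw' : w * conj w = 1 := by rw [Complex.mul_conj', hw]; simp
  have h : ∀ k, w - a k = w * conj (1 - conj (a k) * w) := by
    intro k
    simp only [map_sub, map_one, map_mul, Complex.conj_conj]
    linear_combination (a k) * hw'
  rw [eval_blaschkeNum, eval_blaschkeDen, map_prod, Finset.prod_congr rfl fun k _ => h k,
    Finset.prod_mul_distrib]
  simp [mul_assoc]

/-- On the unit circle `z B'(z) / B(z)` is the positive number `∑ (1 - |aₖ|²) / |z - aₖ|²`. -/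
theorem eval_blaschkeCritical_mul_self (χ : ℂ) {a : Fin n → ℂ} (ha : ∀ k, ‖a k‖ < 1) {w : ℂ}
    (hw : ‖w‖ = 1) :
    (blaschkeCritical χ a).eval w * w = (blaschkeNum χ a).eval w * (blaschkeDen a).eval w *
      ((∑ k, (1 - ‖a k‖ ^ 2) / ‖w - a k‖ ^ 2 : ℝ) : ℂ) := by
  have hw' : w * conj w = 1 := by rw [Complex.mul_conj', hw]; simp
  have hsub : ∀ k, w - a k ≠ 0 := by
    intro k h
    have := ha k
    rw [← sub_eq_zero.mp h, hw] at this
    exact lt_irrefl _ this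
  have hden : ∀ k, 1 - conj (a k) * w ≠ 0 := fun k =>
    Finset.prod_ne_zero_iff.mp (eval_blaschkeDen a w ▸ eval_blaschkeDen_ne_zero ha hw.le) k
      (Finset.mem_univ k)
  have h1 := eval_derivative_prod_eq_mul_sum Finset.univ (fun k => X - C (a k)) w
    (fun k _ => by simpa using hsub k)
  have h2 := eval_derivative_prod_eq_mul_sum Finset.univ (fun k => 1 - C (conj (a k)) * X) w
    (fun k _ => by simpa using hden k)
  have h3 : ((∑ k, (1 - ‖a k‖ ^ 2) / ‖w - a k‖ ^ 2 : ℝ) : ℂ) =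
      w * (∑ k, (w - a k)⁻¹ - ∑ k, -conj (a k) / (1 - conj (a k) * w)) := by
    rw [← Finset.sum_sub_distrib, Finset.mul_sum, Complex.ofReal_sum]
    refine Finset.sum_congr rfl fun k _ => ?_
    have e1 := hsub k
    have e2 := hden k
    have e3 : conj (w - a k) ≠ 0 := (_root_.map_ne_zero _).mpr e1
    push_cast
    rw [← Complex.mul_conj', ← Complex.mul_conj']
    have e4 : 1 - conj (a k) * w = w * conj (w - a k) := by
      rw [map_sub]; linear_combination -hw'
    rw [e4] at e2 ⊢
    have e5 : w ≠ 0 := left_ne_zero_of_mul e2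
    field_simp
    rw [map_sub]
    linear_combination -hw'
  have h4 : (derivative (blaschkeNum χ a)).eval w =
      (blaschkeNum χ a).eval w * ∑ k, (w - a k)⁻¹ := by
    simp only [blaschkeNum, derivative_C_mul, eval_mul, eval_C, h1]
    simp [mul_assoc]
  have h5 : (derivative (blaschkeDen a)).eval w =
      (blaschkeDen a).eval w * ∑ k, -conj (a k) / (1 - conj (a k) * w) := by
    rw [blaschkeDen, h2]
    simp
  rw [h3, blaschkeCritical, wronskian, eval_sub, eval_mul, eval_mul, h4, h5]
  ring

/-- On the unit circle the argument of the numerator of `B'` is that of `χ w ^ (n - 1)`. -/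
theorem eval_blaschkeCritical_of_norm_eq_one (hn : 0 < n) {χ : ℂ} (hχ : ‖χ‖ = 1) {a : Fin n → ℂ}
    (ha : ∀ k, ‖a k‖ < 1) {w : ℂ} (hw : ‖w‖ = 1) :
    (blaschkeCritical χ a).eval w = χ * w ^ (n - 1) * ‖(blaschkeCritical χ a).eval w‖ ∧
      (blaschkeCritical χ a).eval w ≠ 0 := by
  have hw0 : w ≠ 0 := norm_ne_zero_iff.mp (by rw [hw]; exact one_ne_zero)
  have hpos : ∀ k, 0 < (1 - ‖a k‖ ^ 2) / ‖w - a k‖ ^ 2 := by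
    intro k
    have hk := ha k
    refine div_pos (by nlinarith [norm_nonneg (a k)]) (pow_pos (norm_pos_iff.mpr fun h => ?_) 2)
    rw [← sub_eq_zero.mp h, hw] at hk
    exact lt_irrefl _ hk
  have hsum : 0 < ∑ k, (1 - ‖a k‖ ^ 2) / ‖w - a k‖ ^ 2 :=
    Finset.sum_pos (fun k _ => hpos k) ⟨⟨0, hn⟩, Finset.mem_univ _⟩
  have h := eval_blaschkeCritical_mul_self χ ha hw
  set σ := ∑ k, (1 - ‖a k‖ ^ 2) / ‖w - a k‖ ^ 2
  set d := (blaschkeDen a).eval w with hd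
  have hd0 : d ≠ 0 := eval_blaschkeDen_ne_zero ha hw.le
  have hr : 0 < ‖d‖ ^ 2 * σ := mul_pos (pow_pos (norm_pos_iff.mpr hd0) 2) hsum
  have key : (blaschkeCritical χ a).eval w = χ * w ^ (n - 1) * ((‖d‖ ^ 2 * σ : ℝ) : ℂ) := by
    apply mul_right_cancel₀ hw0
    rw [h, eval_blaschkeNum_of_norm_eq_one χ a hw, ← hd]
    obtain ⟨m, rfl⟩ := Nat.exists_eq_succ_of_ne_zero hn.ne'
    push_cast
    rw [← Complex.mul_conj']
    rw [Nat.succ_eq_add_one, pow_succ]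
    ring
  have hnorm : ‖(blaschkeCritical χ a).eval w‖ = ‖d‖ ^ 2 * σ := by
    rw [key, norm_mul, norm_mul, norm_pow, hχ, hw, Complex.norm_real, Real.norm_of_nonneg hr.le]
    simp
  exact ⟨by rw [hnorm]; exact key, norm_pos_iff.mp (hnorm ▸ hr)⟩

/-! ### Zeros of self-inversive polynomials -/

theorem infinite_unit_circle : {w : ℂ | ‖w‖ = 1}.Infinite := by
  have : {w : ℂ | ‖w‖ = 1} = Metric.sphere 0 1 := by ext; simp
  rw [this]
  have hconn := isPreconnected_sphere (E := ℂ) (by simp [Complex.rank_real_complex]) 0 1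
  exact hconn.infinite_of_nontrivial ⟨1, by simp, -1, by simp, by norm_num [Complex.ext_iff]⟩

theorem exists_univ_val_map_eq {α : Type*} (I : Multiset α) (hI : I.card = m) :
    ∃ f : Fin m → α, Finset.univ.val.map f = I := by
  obtain ⟨l, rfl⟩ : ∃ l : List α, (l : Multiset α) = I := Quot.exists_rep I
  obtain rfl : l.length = m := by simpa using hI
  exact ⟨l.get, by rw [Fin.univ_val_map, List.ofFn_get]⟩

theorem norm_circleReflection (x : ℂ) : ‖circleReflection x‖ = ‖x‖⁻¹ := by
  simp [circleReflection]

/-- If `S(w)` has the argument of `χ w ^ m` on the unit circle, then `S(w)` and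
`χ² w ^ (2m) conj (S(w))` agree there. As `conj w = w⁻¹`, the latter is the value of a polynomial
whose zeros are `0`, with multiplicity `2m` minus the number of zeros of `S`, and the reflections of
the zeros of `S`. Since `S(0) ≠ 0` the multiplicity is `0`. -/
theorem roots_eq_map_circleReflection {S : ℂ[X]} {χ : ℂ} (hχ : ‖χ‖ = 1)
    (hdeg : S.natDegree ≤ 2 * m) (h0 : S.eval 0 ≠ 0)
    (hS : ∀ w : ℂ, ‖w‖ = 1 → S.eval w = χ * w ^ m * ‖S.eval w‖) :
    S.roots.card = 2 * m ∧ S.roots.map circleReflection = S.roots := by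
  have hS0 : S ≠ 0 := by rintro rfl; simp at h0
  have hχ0 : χ ≠ 0 := norm_ne_zero_iff.mp (by rw [hχ]; exact one_ne_zero)
  set s := S.leadingCoeff with hs
  have hs0 : s ≠ 0 := leadingCoeff_ne_zero.mpr hS0
  set N := S.roots.card with hN
  have hcard : N ≤ 2 * m := (card_roots' S).trans hdeg
  have hsplit : ∀ w, S.eval w = s * (S.roots.map (w - ·)).prod := fun w =>
    (IsAlgClosed.splits S).eval_eq_prod_roots w
  have heq : S = C (χ ^ 2 * conj s) * X ^ (2 * m - N) *
      (S.roots.map fun r => 1 - C (conj r) * X).prod := by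
    refine eq_of_infinite_eval_eq _ _ (infinite_unit_circle.mono fun w hw => ?_)
    have hw : ‖w‖ = 1 := hw
    have hw' : w * conj w = 1 := by rw [Complex.mul_conj', hw]; simp
    have hχ' : χ * conj χ = 1 := by rw [Complex.mul_conj', hχ]; simp
    have h1 : S.eval w = χ ^ 2 * w ^ (2 * m) * conj (S.eval w) := by
      have h2 := congrArg conj (hS w hw)
      rw [map_mul, map_mul, map_pow, Complex.conj_ofReal] at h2
      rw [h2, hS w hw]
      simp only [norm_mul, norm_pow, hχ, hw, one_pow, one_mul, Complex.norm_real, norm_norm]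
      have h3 : w ^ m * conj w ^ m = 1 := by rw [← mul_pow, hw', one_pow]
      rw [two_mul, pow_add]
      linear_combination (-(‖S.eval w‖ : ℂ) * χ * w ^ m * (χ * conj χ)) * h3
        - ((‖S.eval w‖ : ℂ) * χ * w ^ m) * hχ'
    have h2 : (S.roots.map fun r => 1 - conj r * w).prod =
        w ^ N * conj (S.roots.map (w - ·)).prod := by
      rw [map_multiset_prod, Multiset.map_map, hN, ← Multiset.prod_replicate,
        ← Multiset.map_const', ← Multiset.prod_map_mul]
      refine congrArg _ (Multiset.map_congr rfl fun r _ => ?_)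
      rw [Function.comp_apply, map_sub]
      linear_combination -hw'
    show S.eval w = _
    rw [h1, eval_mul, eval_mul, eval_C, eval_pow, eval_X, eval_multiset_prod, Multiset.map_map]
    simp only [Function.comp_def, eval_sub, eval_one, eval_mul, eval_C, eval_X]
    rw [h2, hsplit, map_mul]
    have : w ^ (2 * m) = w ^ (2 * m - N) * w ^ N := by rw [← pow_add, Nat.sub_add_cancel hcard]
    rw [this]; ring
  have hNeq : N = 2 * m := by
    by_contra hne
    apply h0
    rw [heq, eval_mul, eval_mul, eval_pow, eval_X, zero_pow (by omega)]
    simp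
  refine ⟨hNeq, ?_⟩
  have hr0 : ∀ r ∈ S.roots, r ≠ 0 := by
    rintro r hr rfl
    exact h0 ((mem_roots hS0).mp hr)
  have hprod : (S.roots.map fun r => 1 - C (conj r) * X).prod =
      C (S.roots.map fun r => -conj r).prod *
        ((S.roots.map circleReflection).map fun r => X - C r).prod := by
    rw [Multiset.map_map, map_multiset_prod, Multiset.map_map, ← Multiset.prod_map_mul]
    refine congrArg _ (Multiset.map_congr rfl fun r hr => ?_)
    have : conj r ≠ 0 := by simpa using hr0 r hr
    simp only [Function.comp_apply, circleReflection]
    rw [mul_sub, ← C_mul, mul_one_div, neg_div, div_self this]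
    simp
    ring
  rw [hNeq, Nat.sub_self, pow_zero, mul_one, hprod, ← mul_assoc, ← C_mul] at heq
  have hc : χ ^ 2 * conj s * (S.roots.map fun r => -conj r).prod ≠ 0 := by
    intro hc
    rw [hc, C_0, zero_mul] at heq
    exact hS0 heq
  conv_rhs => rw [heq, roots_C_mul _ hc, roots_multiset_prod_X_sub_C]

/-- The zeros of a self-inversive polynomial that vanishes neither at `0` nor on the unit circle form
pairs `ζ`, `ζ*` with `ζ` in the disc. -/
theorem exists_eq_prod_pairs {S : ℂ[X]} {χ : ℂ} (hχ : ‖χ‖ = 1)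
    (hdeg : S.natDegree ≤ 2 * m) (h0 : S.eval 0 ≠ 0)
    (hS : ∀ w : ℂ, ‖w‖ = 1 → S.eval w = χ * w ^ m * ‖S.eval w‖ ∧ S.eval w ≠ 0) :
    ∃ ζ : Fin m → ℂ, (∀ k, ‖ζ k‖ < 1 ∧ ζ k ≠ 0) ∧
      S = C S.leadingCoeff * ∏ k, ((X - C (ζ k)) * (X - C (circleReflection (ζ k)))) := by
  have hS0 : S ≠ 0 := by rintro rfl; simp at h0
  obtain ⟨hcard, hmap⟩ := roots_eq_map_circleReflection hχ hdeg h0 fun w hw => (hS w hw).1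
  have hroot : ∀ r ∈ S.roots, r ≠ 0 ∧ ‖r‖ ≠ 1 := by
    intro r hr
    have hr' : S.eval r = 0 := (mem_roots hS0).mp hr
    exact ⟨by rintro rfl; exact h0 hr', fun h => (hS r h).2 hr'⟩
  set I := S.roots.filter (fun r => ‖r‖ < 1) with hI
  have hsum : I + I.map circleReflection = S.roots := by
    have h1 : I.map circleReflection = S.roots.filter (fun r => ¬ ‖r‖ < 1) := by
      conv_rhs => rw [← hmap, Multiset.filter_map]
      refine congrArg _ (Multiset.filter_congr fun r hr => ?_)
      obtain ⟨h2, h3⟩ := hroot r hr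
      simp only [Function.comp_apply, norm_circleReflection, not_lt]
      rw [one_le_inv₀ (norm_pos_iff.mpr h2)]
      exact ⟨le_of_lt, fun h => lt_of_le_of_ne h h3⟩
    rw [h1, hI, Multiset.filter_add_not]
  have hIcard : I.card = m := by
    have := congrArg Multiset.card hsum
    rw [Multiset.card_add, Multiset.card_map, hcard] at this
    omega
  obtain ⟨ζ, hζ⟩ := exists_univ_val_map_eq I hIcard
  refine ⟨ζ, fun k => ?_, ?_⟩
  · have hk : ζ k ∈ I := hζ ▸ Multiset.mem_map_of_mem ζ (Finset.mem_univ_val k)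
    rw [hI, Multiset.mem_filter] at hk
    exact ⟨hk.2, (hroot _ hk.1).1⟩
  · conv_lhs => rw [(IsAlgClosed.splits S).eq_prod_roots, ← hsum, Multiset.map_add,
      Multiset.prod_add, Multiset.map_map, ← Multiset.prod_map_mul, ← hζ, Multiset.map_map]
    rfl

/-! ### The energy -/

/-- `log ‖f‖` is near `x` the constant `log ‖f x‖` plus the real part of the principal branch of
`log (f / f x)`. -/
theorem hasFDerivAt_log_norm {E : Type*} [NormedAddCommGroup E] [NormedSpace ℂ E]
    [NormedSpace ℝ E] [IsScalarTower ℝ ℂ E]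
    {f : E → ℂ} {f' : E →L[ℂ] ℂ} {x : E} (hf : HasFDerivAt f f' x) (hx : f x ≠ 0) :
    HasFDerivAt (fun y => Real.log ‖f y‖)
      (Complex.reCLM.comp (((f x)⁻¹ • f').restrictScalars ℝ)) x := by
  have h1 : HasFDerivAt (fun y => (f x)⁻¹ * f y) ((f x)⁻¹ • f') x := hf.const_mul _
  have h2 := h1.clog (by rw [inv_mul_cancel₀ hx]; exact Complex.one_mem_slitPlane)
  rw [inv_mul_cancel₀ hx, inv_one, one_smul] at h2
  have h3 := (Complex.reCLM.hasFDerivAt.comp x (h2.restrictScalars ℝ)).const_add (Real.log ‖f x‖)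
  refine h3.congr_of_eventuallyEq ?_
  filter_upwards [hf.continuousAt.eventually_ne hx] with y hy
  simp only [Function.comp_apply, Complex.reCLM_apply, Complex.log_re, norm_mul, norm_inv]
  rw [Real.log_mul (inv_ne_zero (norm_ne_zero_iff.mpr hx)) (norm_ne_zero_iff.mpr hy), Real.log_inv]
  ring

/-- The balance of forces at each of the points `zⱼ` makes `z` a critical point of the energy. -/
theorem hasFDerivAt_energy {ζ : Fin m → ℂ} {z : Fin n → ℂ} (hz : Function.Injective z)
    (h1 : ∀ j k, z j ≠ ζ k) (h2 : ∀ j k, z j ≠ circleReflection (ζ k))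
    (hcrit : ∀ j, ∑ k, ((z j - ζ k)⁻¹ + (z j - circleReflection (ζ k))⁻¹) =
      2 * ∑ k ∈ Finset.univ.erase j, (z j - z k)⁻¹) :
    HasFDerivAt (energy ζ) (0 : (Fin n → ℂ) →L[ℝ] ℝ) z := by
  let p : Fin n → (Fin n → ℂ) →L[ℂ] ℂ := fun j => ContinuousLinearMap.proj j
  have hp : ∀ j, HasFDerivAt (fun w : Fin n → ℂ => w j) (p j) z := fun j => (p j).hasFDerivAt
  have hA : ∀ k j, HasFDerivAt (fun w : Fin n → ℂ =>
      Real.log ‖(w j - ζ k) * (w j - circleReflection (ζ k))‖) _ z := fun k j =>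
    hasFDerivAt_log_norm (((hp j).sub_const (ζ k)).mul ((hp j).sub_const (circleReflection (ζ k))))
      (mul_ne_zero (sub_ne_zero.mpr (h1 j k)) (sub_ne_zero.mpr (h2 j k)))
  have hB : ∀ j, ∀ k ∈ Finset.Ioi j, HasFDerivAt (fun w : Fin n → ℂ =>
      Real.log ‖w j - w k‖) _ z := fun j k hk =>
    hasFDerivAt_log_norm ((hp j).sub (hp k))
      (sub_ne_zero.mpr (hz.ne (Finset.mem_Ioi.mp hk).ne))
  have hE := (HasFDerivAt.fun_sum fun k (_ : k ∈ Finset.univ) =>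
      HasFDerivAt.fun_sum fun j (_ : j ∈ Finset.univ) => hA k j).sub
    ((HasFDerivAt.fun_sum fun j (_ : j ∈ Finset.univ) => HasFDerivAt.fun_sum (hB j)).const_mul 2)
  refine hE.congr_fderiv ?_
  ext h
  simp only [sub_apply, sum_apply,
    smul_apply, ContinuousLinearMap.comp_apply, Complex.reCLM_apply,
    ContinuousLinearMap.coe_restrictScalars', zero_apply,
    add_apply, smul_eq_mul, p, ContinuousLinearMap.proj_apply]
  have e1 : ∀ k j, ((z j - ζ k) * (z j - circleReflection (ζ k)))⁻¹ *
      ((z j - ζ k) * h j + (z j - circleReflection (ζ k)) * h j) =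
      ((z j - ζ k)⁻¹ + (z j - circleReflection (ζ k))⁻¹) * h j := by
    intro k j
    have := sub_ne_zero.mpr (h1 j k)
    have := sub_ne_zero.mpr (h2 j k)
    field_simp
    ring
  have e2 : ∑ j, ∑ k ∈ Finset.Ioi j, (z j - z k)⁻¹ * (h j - h k) =
      ∑ j, ∑ k ∈ Finset.univ.erase j, (z j - z k)⁻¹ * h j := by
    have := Finset.sum_sum_Ioi_add_eq_sum_sum_off_diag fun k j => (z j - z k)⁻¹ * h j
    simp_rw [Finset.compl_eq_univ_sdiff, Finset.sdiff_singleton_eq_erase] at this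
    rw [← this]
    refine Finset.sum_congr rfl fun j _ => Finset.sum_congr rfl fun k _ => ?_
    rw [← neg_sub (z j) (z k), inv_neg]
    ring
  simp_rw [e1]
  simp only [← Complex.re_sum]
  rw [e2, Finset.sum_comm]
  simp_rw [← Finset.sum_mul, hcrit, mul_assoc, ← Finset.mul_sum]
  simp

/-- If `S` is a polynomial whose zeros are the protons, the energy is, up to an additive constant, the
logarithm of `∏ |S(wⱼ)| / |V(w)|²`, with `V` the Vandermonde determinant. -/
theorem energy_eq_log_det_vandermonde {ζ : Fin m → ℂ} {S : ℂ[X]}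
    (hS : S = C S.leadingCoeff * ∏ k, ((X - C (ζ k)) * (X - C (circleReflection (ζ k)))))
    {w : Fin n → ℂ} (hw : Function.Injective w) (hSw : ∀ j, S.eval (w j) ≠ 0) :
    energy ζ w = Real.log (∏ j, ‖S.eval (w j)‖) - n * Real.log ‖S.leadingCoeff‖ -
      Real.log (‖(Matrix.vandermonde w).det‖ ^ 2) := by
  have heval : ∀ x, S.eval x =
      S.leadingCoeff * ∏ k, ((x - ζ k) * (x - circleReflection (ζ k))) := by
    intro x
    conv_lhs => rw [hS]
    simp [eval_prod]
  have h1 : ∀ j, Real.log ‖S.eval (w j)‖ = Real.log ‖S.leadingCoeff‖ +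
      ∑ k, Real.log ‖(w j - ζ k) * (w j - circleReflection (ζ k))‖ := by
    intro j
    have h0 := hSw j
    rw [heval] at h0 ⊢
    rw [norm_mul, Real.log_mul (norm_ne_zero_iff.mpr (left_ne_zero_of_mul h0))
      (norm_ne_zero_iff.mpr (right_ne_zero_of_mul h0)), norm_prod, Real.log_prod]
    intro k _
    exact norm_ne_zero_iff.mpr (Finset.prod_ne_zero_iff.mp (right_ne_zero_of_mul h0) k
      (Finset.mem_univ k))
  have h2 : Real.log ‖(Matrix.vandermonde w).det‖ =
      ∑ j, ∑ k ∈ Finset.Ioi j, Real.log ‖w j - w k‖ := by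
    have hne : ∀ j, ∀ k ∈ Finset.Ioi j, ‖w k - w j‖ ≠ 0 := fun j k hk =>
      norm_ne_zero_iff.mpr (sub_ne_zero.mpr (hw.ne (Finset.mem_Ioi.mp hk).ne'))
    simp only [Matrix.det_vandermonde, norm_prod]
    rw [Real.log_prod fun j _ => Finset.prod_ne_zero_iff.mpr (hne j)]
    refine Finset.sum_congr rfl fun j _ => ?_
    rw [Real.log_prod (hne j)]
    exact Finset.sum_congr rfl fun k _ => by rw [norm_sub_rev]
  rw [Real.log_prod fun j _ => norm_ne_zero_iff.mpr (hSw j), Real.log_pow, h2,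
    Finset.sum_congr rfl fun j _ => h1 j, Finset.sum_add_distrib, Finset.sum_comm]
  simp [energy]

/-- The minimality of the energy at `z`: Hadamard's inequality for the matrix
`√|S(zⱼ)| Lⱼ(wᵢ)`, whose `i`-th row has squared length `|S(wᵢ)|`. -/
theorem prod_mul_vandermonde_le {S : ℂ[X]} {z : Fin n → ℂ} (hz : Function.Injective z)
    {w : Fin n → ℂ} (hS : ∀ i, ‖S.eval (w i)‖ =
      ∑ j, ‖S.eval (z j)‖ * ‖(lagrangeBasis z j).eval (w i)‖ ^ 2) :
    (∏ j, ‖S.eval (z j)‖) * ‖(Matrix.vandermonde w).det‖ ^ 2 ≤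
      (∏ i, ‖S.eval (w i)‖) * ‖(Matrix.vandermonde z).det‖ ^ 2 := by
  have h := norm_det_sq_le_prod_row_norm
    (Matrix.of fun i j => (√‖S.eval (z j)‖ : ℂ) * (lagrangeBasis z j).eval (w i))
  have h1 : ∀ i, ∑ j, ‖(√‖S.eval (z j)‖ : ℂ) * (lagrangeBasis z j).eval (w i)‖ ^ 2 =
      ‖S.eval (w i)‖ := by
    intro i
    rw [hS]
    refine Finset.sum_congr rfl fun j _ => ?_
    rw [norm_mul, mul_pow, Complex.norm_real, Real.norm_of_nonneg (Real.sqrt_nonneg _),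
      Real.sq_sqrt (norm_nonneg _)]
  simp only [Matrix.of_apply, h1] at h
  have h2 := Matrix.det_mul_row (fun j => (√‖S.eval (z j)‖ : ℂ))
    (Matrix.of fun i j => (lagrangeBasis z j).eval (w i))
  simp only [Matrix.of_apply] at h2
  rw [h2, norm_mul, mul_pow, norm_prod, ← Finset.prod_pow] at h
  simp only [Complex.norm_real, Real.norm_of_nonneg (Real.sqrt_nonneg _),
    Real.sq_sqrt (norm_nonneg _)] at h
  rw [← det_lagrangeBasis_mul_vandermonde hz w, norm_mul, mul_pow, ← mul_assoc]
  exact mul_le_mul_of_nonneg_right h (by positivity)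

/-! ### The energy at the fibre of an interpolating Blaschke product -/

theorem IsInterpolatingBlaschke.eval_num_eq_eval_den {z : Fin n → ℂ} (hz : ∀ j, ‖z j‖ = 1)
    {χ : ℂ} {a : Fin n → ℂ} (hB : IsInterpolatingBlaschke z χ a) (j : Fin n) :
    (blaschkeNum χ a).eval (z j) = (blaschkeDen a).eval (z j) := by
  have h := hB.2.2.1 j
  rwa [blaschke_eq_div, div_eq_one_iff_eq (eval_blaschkeDen_ne_zero hB.2.1 (hz j).le)] at h

theorem IsInterpolatingBlaschke.critical_eq_sum {z : Fin n → ℂ} (hz : ∀ j, ‖z j‖ = 1)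
    (hinj : Function.Injective z) {χ : ℂ} {a : Fin n → ℂ} (hB : IsInterpolatingBlaschke z χ a) :
    blaschkeCritical χ a =
      ∑ j, C ((blaschkeCritical χ a).eval (z j)) * lagrangeBasis z j ^ 2 := by
  have h := wronskian_eq_sum hinj (P := blaschkeNum χ a) (Q := blaschkeDen a)
    (by simpa using natDegree_blaschkeNum_le χ a) (by simpa using natDegree_blaschkeDen_le a)
    (hB.eval_num_eq_eval_den hz)
  rw [← blaschkeCritical] at h
  conv_lhs => rw [h]
  refine Finset.sum_congr rfl fun j _ => ?_
  rw [h, eval_sum_sq_lagrangeBasis_node hinj]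

theorem natDegree_sum_sq_lagrangeBasis_le {z : Fin n → ℂ} (hinj : Function.Injective z)
    (d : Fin n → ℂ) : (∑ j, C (d j) * lagrangeBasis z j ^ 2).natDegree ≤ 2 * (n - 1) := by
  refine natDegree_sum_le_of_forall_le _ _ fun j _ => (natDegree_C_mul_le _ _).trans ?_
  refine natDegree_pow_le.trans_eq ?_
  rw [lagrangeBasis, Lagrange.natDegree_basis hinj.injOn (Finset.mem_univ j), Finset.card_univ,
    Fintype.card_fin]

/-- On the unit circle all terms of the expansion of `S`, the numerator of `B'`, in squares of Lagrange
basis polynomials have the same argument, so that the expansion holds for absolute values. -/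
theorem IsInterpolatingBlaschke.norm_eval_critical (hn : 0 < n) {z : Fin n → ℂ}
    (hz : ∀ j, ‖z j‖ = 1) (hinj : Function.Injective z) {χ : ℂ} {a : Fin n → ℂ}
    (hB : IsInterpolatingBlaschke z χ a) {w : ℂ} (hw : ‖w‖ = 1) :
    ‖(blaschkeCritical χ a).eval w‖ = ∑ j, ‖(blaschkeCritical χ a).eval (z j)‖ *
      ‖(lagrangeBasis z j).eval w‖ ^ 2 := by
  have hunit : ∀ {x : ℂ}, ‖x‖ = 1 → x ≠ 0 := fun hx =>
    norm_ne_zero_iff.mp (by rw [hx]; exact one_ne_zero)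
  have hc : χ * w ^ (n - 1) ≠ 0 := mul_ne_zero (hunit hB.1) (pow_ne_zero _ (hunit hw))
  have h1 := congrArg (eval w) (hB.critical_eq_sum hz hinj)
  rw [eval_finsetSum] at h1
  rw [(eval_blaschkeCritical_of_norm_eq_one hn hB.1 hB.2.1 hw).1] at h1
  have h2 : ∀ j, (C ((blaschkeCritical χ a).eval (z j)) * lagrangeBasis z j ^ 2).eval w =
      χ * w ^ (n - 1) * ((‖(blaschkeCritical χ a).eval (z j)‖ *
        ‖(lagrangeBasis z j).eval w‖ ^ 2 : ℝ) : ℂ) := by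
    intro j
    rw [eval_mul, eval_C, eval_pow, sq_eval_lagrangeBasis_of_norm_eq_one hz hw,
      (eval_blaschkeCritical_of_norm_eq_one hn hB.1 hB.2.1 (hz j)).1]
    have := pow_ne_zero (n - 1) (hunit (hz j))
    simp only [norm_mul, norm_pow, hB.1, hz j, one_pow, one_mul, Complex.norm_real, norm_norm]
    push_cast
    rw [div_pow]
    field_simp
  rw [Finset.sum_congr rfl fun j _ => h2 j, ← Finset.mul_sum] at h1
  have h3 := mul_left_cancel₀ hc h1
  exact_mod_cast h3

/-- The protons are the critical points of `B` in the disc. -/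
theorem IsInterpolatingBlaschke.exists_energy_critical_isMinOn (hn : 0 < n) {z : Fin n → ℂ}
    (hz : ∀ j, ‖z j‖ = 1) (hinj : Function.Injective z) {χ : ℂ} {a : Fin n → ℂ}
    (hB : IsInterpolatingBlaschke z χ a) :
    ∃ ζ : Fin (n - 1) → ℂ, (∀ k, ‖ζ k‖ < 1 ∧ ζ k ≠ 0) ∧
      HasFDerivAt (energy ζ) (0 : (Fin n → ℂ) →L[ℝ] ℝ) z ∧
      IsMinOn (energyExt ζ) {w : Fin n → ℂ | ∀ j, ‖w j‖ = 1} z := by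
  have hsum := hB.critical_eq_sum hz hinj
  have hcirc := fun (w : ℂ) (hw : ‖w‖ = 1) =>
    eval_blaschkeCritical_of_norm_eq_one hn hB.1 hB.2.1 hw
  have hnorm := fun (w : ℂ) (hw : ‖w‖ = 1) => hB.norm_eval_critical hn hz hinj hw
  have h0 : (blaschkeCritical χ a).eval 0 ≠ 0 := deriv_blaschke_zero χ a ▸ hB.2.2.2
  have hdeg : (blaschkeCritical χ a).natDegree ≤ 2 * (n - 1) := by
    rw [hsum]; exact natDegree_sum_sq_lagrangeBasis_le hinj _
  generalize blaschkeCritical χ a = S at *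
  obtain ⟨ζ, hζ, hS⟩ := exists_eq_prod_pairs hB.1 hdeg h0 hcirc
  have hζ1 : ∀ w : ℂ, ‖w‖ = 1 → ∀ k, w - ζ k ≠ 0 := by
    intro w hw k h
    exact (hζ k).1.ne (by rw [← sub_eq_zero.mp h, hw])
  have hζ2 : ∀ w : ℂ, ‖w‖ = 1 → ∀ k, w - circleReflection (ζ k) ≠ 0 := by
    intro w hw k h
    have h1 := norm_circleReflection (ζ k)
    rw [← sub_eq_zero.mp h, hw, eq_comm, inv_eq_one] at h1
    exact (hζ k).1.ne h1
  refine ⟨ζ, hζ, hasFDerivAt_energy hinj (fun j k => sub_ne_zero.mp (hζ1 _ (hz j) k))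
    (fun j k => sub_ne_zero.mp (hζ2 _ (hz j) k)) fun j => ?_, ?_⟩
  · have e1 : (derivative S).eval (z j) =
        2 * S.eval (z j) * ∑ k ∈ Finset.univ.erase j, (z j - z k)⁻¹ := by
      conv_lhs => rw [hsum]
      exact eval_derivative_sum_sq_lagrangeBasis hinj _ j
    have e2 : (derivative S).eval (z j) =
        S.eval (z j) * ∑ k, ((z j - ζ k)⁻¹ + (z j - circleReflection (ζ k))⁻¹) := by
      have e3 := eval_derivative_prod_eq_mul_sum Finset.univ
        (fun k => (X - C (ζ k)) * (X - C (circleReflection (ζ k)))) (z j)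
        (fun k _ => by simpa using ⟨hζ1 _ (hz j) k, hζ2 _ (hz j) k⟩)
      generalize S.leadingCoeff = s at hS
      subst hS
      rw [derivative_C_mul, eval_mul, e3, eval_mul, mul_assoc]
      refine congrArg _ (congrArg _ (Finset.sum_congr rfl fun k _ => ?_))
      have := hζ1 _ (hz j) k
      have := hζ2 _ (hz j) k
      simp only [derivative_mul, derivative_sub, derivative_X, derivative_C, eval_add, eval_mul,
        eval_sub, eval_X, eval_C, sub_zero, eval_one]
      field_simp
    refine mul_left_cancel₀ (hcirc _ (hz j)).2 ?_
    rw [← e2, e1]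
    ring
  · intro w hw
    have hw : ∀ j, ‖w j‖ = 1 := hw
    show energyExt ζ z ≤ energyExt ζ w
    rw [energyExt, energyExt, if_pos hinj]
    split_ifs with hwinj
    · rw [EReal.coe_le_coe_iff,
        energy_eq_log_det_vandermonde hS hinj fun j => (hcirc _ (hz j)).2,
        energy_eq_log_det_vandermonde hS hwinj fun j => (hcirc _ (hw j)).2]
      have key := prod_mul_vandermonde_le hinj fun i => hnorm (w i) (hw i)
      have p1 : ∀ v : Fin n → ℂ, (∀ j, ‖v j‖ = 1) → 0 < ∏ j, ‖S.eval (v j)‖ := fun v hv =>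
        Finset.prod_pos fun j _ => norm_pos_iff.mpr (hcirc _ (hv j)).2
      have p2 : ∀ v : Fin n → ℂ, Function.Injective v → 0 < ‖(Matrix.vandermonde v).det‖ ^ 2 :=
        fun v hv => pow_pos (norm_pos_iff.mpr (Matrix.det_vandermonde_ne_zero_iff.mpr hv)) 2
      have hlog := Real.log_le_log (mul_pos (p1 z hz) (p2 w hwinj)) key
      rw [Real.log_mul (p1 z hz).ne' (p2 w hwinj).ne', Real.log_mul (p1 w hw).ne' (p2 z hinj).ne']
        at hlog
      linarith
    · exact le_top

/-! ### Existence of interpolating Blaschke products -/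

/-- The product of `F + 1` and the node polynomial `∏ₖ (X - zₖ)`, where
`F = ∑ⱼ tⱼ (X + zⱼ) / (X - zⱼ)`. The real part of `-F` is a Poisson integral of the point masses `tⱼ`
at `zⱼ`, and the zeros of this polynomial will be the zeros of a Blaschke product. -/
def herglotzNum (z : Fin n → ℂ) (t : Fin n → ℝ) : ℂ[X] :=
  ∑ j, C (t j : ℂ) * ((X + C (z j)) * Lagrange.nodal (Finset.univ.erase j) z) + nodePoly z

theorem eval_herglotzNum_node (z : Fin n → ℂ) (t : Fin n → ℝ) (j : Fin n) :
    (herglotzNum z t).eval (z j) = 2 * t j * z j * (derivative (nodePoly z)).eval (z j) := by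
  rw [herglotzNum, eval_add, nodePoly, Lagrange.eval_nodal_at_node (Finset.mem_univ j), add_zero,
    eval_finsetSum, Finset.sum_eq_single j]
  · rw [Lagrange.eval_nodal_derivative_eval_node_eq (Finset.mem_univ j)]
    simp only [eval_mul, eval_add, eval_C, eval_X]
    ring
  · intro i _ hij
    rw [eval_mul, eval_mul, Lagrange.eval_nodal_at_node
      (Finset.mem_erase.mpr ⟨hij.symm, Finset.mem_univ j⟩), mul_zero, mul_zero]
  · simp

theorem monic_X_add_C_mul_nodal_erase (z : Fin n → ℂ) (j : Fin n) :
    ((X + C (z j)) * Lagrange.nodal (Finset.univ.erase j) z).Monic ∧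
    ((X + C (z j)) * Lagrange.nodal (Finset.univ.erase j) z).natDegree = n := by
  have h1 := monic_X_add_C (z j)
  have h2 : (Lagrange.nodal (Finset.univ.erase j) z).Monic := Lagrange.nodal_monic
  refine ⟨h1.mul h2, ?_⟩
  rw [h1.natDegree_mul h2, natDegree_X_add_C, Lagrange.natDegree_nodal,
    Finset.card_erase_of_mem (Finset.mem_univ j), Finset.card_univ, Fintype.card_fin]
  have := j.pos
  omega

theorem natDegree_nodePoly (z : Fin n → ℂ) : (nodePoly z).natDegree = n := by
  rw [nodePoly, Lagrange.natDegree_nodal, Finset.card_univ, Fintype.card_fin]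

theorem natDegree_herglotzNum_le (z : Fin n → ℂ) (t : Fin n → ℝ) :
    (herglotzNum z t).natDegree ≤ n := by
  refine natDegree_add_le_of_degree_le (natDegree_sum_le_of_forall_le _ _ fun j _ =>
    (natDegree_C_mul_le _ _).trans (monic_X_add_C_mul_nodal_erase z j).2.le)
    (natDegree_nodePoly z).le

theorem coeff_herglotzNum (z : Fin n → ℂ) (t : Fin n → ℝ) :
    (herglotzNum z t).coeff n = ((∑ j, t j + 1 : ℝ) : ℂ) := by
  have h1 : ∀ j, ((X + C (z j)) * Lagrange.nodal (Finset.univ.erase j) z).coeff n = 1 := by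
    intro j
    obtain ⟨h, h'⟩ := monic_X_add_C_mul_nodal_erase z j
    have := h.coeff_natDegree
    rwa [h'] at this
  have h2 : (nodePoly z).coeff n = 1 := by
    have : (nodePoly z).coeff (nodePoly z).natDegree = 1 := Lagrange.nodal_monic
    rwa [natDegree_nodePoly] at this
  rw [herglotzNum, coeff_add, finsetSum_coeff, h2]
  simp only [coeff_C_mul, h1, mul_one]
  push_cast
  rfl

theorem re_add_div_sub {x z : ℂ} (hz : ‖z‖ = 1) :
    ((x + z) / (x - z)).re = (‖x‖ ^ 2 - 1) / ‖x - z‖ ^ 2 := by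
  have h : z.re ^ 2 + z.im ^ 2 = 1 := by
    have := Complex.sq_norm z
    rw [hz, Complex.normSq_apply] at this
    linarith
  rw [Complex.div_re, Complex.sq_norm, Complex.sq_norm, ← add_div]
  congr 1
  simp only [Complex.normSq_apply, Complex.add_re, Complex.sub_re, Complex.add_im, Complex.sub_im]
  linear_combination -h

/-- At a zero `Re F = -1`, whereas `Re F ≥ 0` off the open unit disc. -/
theorem norm_lt_one_of_herglotzNum_eq_zero {z : Fin n → ℂ} (hz : ∀ j, ‖z j‖ = 1)
    (hinj : Function.Injective z) {t : Fin n → ℝ} (ht : ∀ j, 0 < t j) {x : ℂ}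
    (hx : (herglotzNum z t).eval x = 0) : ‖x‖ < 1 := by
  have hz0 : ∀ j, z j ≠ 0 := fun j => norm_ne_zero_iff.mp (by rw [hz j]; exact one_ne_zero)
  have hxz : ∀ j, x - z j ≠ 0 := by
    intro j h
    rw [sub_eq_zero.mp h, eval_herglotzNum_node] at hx
    have h1 := eval_derivative_nodePoly_ne_zero hinj j
    have h2 : (t j : ℂ) ≠ 0 := by exact_mod_cast (ht j).ne'
    simp [h1, h2, hz0 j] at hx
  have hN : (nodePoly z).eval x ≠ 0 := by
    rw [nodePoly, Lagrange.eval_nodal]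
    exact Finset.prod_ne_zero_iff.mpr fun j _ => hxz j
  have h1 : (herglotzNum z t).eval x =
      (nodePoly z).eval x * (∑ j, t j * ((x + z j) / (x - z j)) + 1) := by
    rw [herglotzNum, eval_add, eval_finsetSum, mul_add, mul_one, Finset.mul_sum]
    congr 1
    refine Finset.sum_congr rfl fun j _ => ?_
    rw [nodePoly, Lagrange.nodal_eq_mul_nodal_erase (Finset.mem_univ j)]
    simp only [eval_mul, eval_add, eval_sub, eval_X, eval_C]
    have := hxz j
    field_simp
  rw [h1] at hx
  have h2 := congrArg Complex.re ((mul_eq_zero.mp hx).resolve_left hN)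
  simp only [Complex.add_re, Complex.re_sum, Complex.re_ofReal_mul, re_add_div_sub (hz _),
    Complex.one_re, Complex.zero_re] at h2
  by_contra! hge
  have h3 : 0 ≤ ∑ j, t j * ((‖x‖ ^ 2 - 1) / ‖x - z j‖ ^ 2) :=
    Finset.sum_nonneg fun j _ => mul_nonneg (ht j).le
      (div_nonneg (by nlinarith) (by positivity))
  linarith

/-- The quotient of the values of `p` and of its reciprocal polynomial `x ^ n conj (p (1 / conj x))` is
the same unimodular number at all the nodes. -/
theorem eval_herglotzNum_node_eq_conj {z : Fin n → ℂ} (hz : ∀ j, ‖z j‖ = 1) (t : Fin n → ℝ)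
    (j : Fin n) : (herglotzNum z t).eval (z j) =
      ((-1) ^ (n - 1) * ∏ k, z k) * (z j ^ n * conj ((herglotzNum z t).eval (z j))) := by
  have hconj : ∀ k, z k * conj (z k) = 1 := fun k => by rw [Complex.mul_conj', hz k]; simp
  have h1 : ∏ k ∈ Finset.univ.erase j, (z j - z k) = (-1) ^ (n - 1) * z j ^ (n - 1) *
      (∏ k ∈ Finset.univ.erase j, z k) * conj (∏ k ∈ Finset.univ.erase j, (z j - z k)) := by
    have hcard : n - 1 = (Finset.univ.erase j).card := by
      rw [Finset.card_erase_of_mem (Finset.mem_univ j), Finset.card_univ, Fintype.card_fin]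
    rw [hcard, ← mul_pow, ← Finset.prod_const, map_prod, ← Finset.prod_mul_distrib,
      ← Finset.prod_mul_distrib]
    refine Finset.prod_congr rfl fun k _ => ?_
    rw [map_sub]
    linear_combination z k * hconj j - z j * hconj k
  have h2 : z j ^ n = z j ^ (n - 1) * z j := by
    rw [← pow_succ, Nat.sub_add_cancel j.pos]
  rw [eval_herglotzNum_node, eval_derivative_nodePoly, map_mul, map_mul, map_mul,
    Complex.conj_ofReal, Complex.conj_ofNat, ← Finset.mul_prod_erase _ z (Finset.mem_univ j), h2]
  linear_combination (2 * (t j : ℂ) * z j) * h1 - 2 * t j * z j * ((-1) ^ (n - 1) * z j ^ (n - 1) *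
      (∏ k ∈ Finset.univ.erase j, z k) * conj (∏ k ∈ Finset.univ.erase j, (z j - z k))) * hconj j

/-- Positive weights `tⱼ` with `∑ tⱼ / zⱼ ≠ 0` give a Blaschke product whose zeros are those of
`herglotzNum z t`; that sum is, up to a nonzero factor, its derivative at `0`. -/
theorem exists_isInterpolatingBlaschke (hn : 0 < n) {z : Fin n → ℂ} (hz : ∀ j, ‖z j‖ = 1)
    (hinj : Function.Injective z) :
    ∃ (χ : ℂ) (a : Fin n → ℂ), IsInterpolatingBlaschke z χ a := by
  have hz0 : ∀ j, z j ≠ 0 := fun j => norm_ne_zero_iff.mp (by rw [hz j]; exact one_ne_zero)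
  obtain ⟨t, ht, hsum⟩ : ∃ t : Fin n → ℝ, (∀ j, 0 < t j) ∧ ∑ j, (t j : ℂ) * (z j)⁻¹ ≠ 0 := by
    -- Equal weights do unless the sum vanishes, and then increasing one of them does.
    by_cases h : ∑ j, (z j)⁻¹ = 0
    · refine ⟨fun j => if j = ⟨0, hn⟩ then 2 else 1, fun j => by dsimp only; split_ifs <;> norm_num, ?_⟩
      have : ∀ j : Fin n, (((if j = ⟨0, hn⟩ then 2 else 1 : ℝ)) : ℂ) * (z j)⁻¹ =
          (if j = ⟨0, hn⟩ then (z j)⁻¹ else 0) + (z j)⁻¹ := by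
        intro j
        split_ifs <;> push_cast <;> ring
      rw [Finset.sum_congr rfl fun j _ => this j, Finset.sum_add_distrib, h]
      simpa using hz0 _
    · exact ⟨fun _ => 1, fun _ => one_pos, by simpa using h⟩
  set p := herglotzNum z t with hp
  have hc : (0 : ℝ) < ∑ j, t j + 1 := by
    have := Finset.sum_nonneg fun j (_ : j ∈ Finset.univ) => (ht j).le
    linarith
  set c : ℝ := ∑ j, t j + 1 with hcdef
  have hc0 : (c : ℂ) ≠ 0 := by exact_mod_cast hc.ne'
  have hcoeff : p.coeff n = c := coeff_herglotzNum z t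
  have hdeg : p.natDegree = n := le_antisymm (natDegree_herglotzNum_le z t)
    (le_natDegree_of_ne_zero (by rw [hcoeff]; exact hc0))
  have hlead : p.leadingCoeff = c := by rw [leadingCoeff, hdeg, hcoeff]
  have hp0 : p ≠ 0 := leadingCoeff_ne_zero.mp (by rw [hlead]; exact hc0)
  obtain ⟨a, ha⟩ := exists_univ_val_map_eq p.roots
    ((IsAlgClosed.splits p).natDegree_eq_card_roots.symm.trans hdeg)
  have ha1 : ∀ k, ‖a k‖ < 1 := by
    intro k
    have : a k ∈ p.roots := ha ▸ Multiset.mem_map_of_mem a (Finset.mem_univ_val k)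
    exact norm_lt_one_of_herglotzNum_eq_zero hz hinj ht ((mem_roots hp0).mp this)
  have hpe : ∀ x, p.eval x = c * ∏ k, (x - a k) := by
    intro x
    rw [(IsAlgClosed.splits p).eval_eq_prod_roots, hlead, ← ha, Multiset.map_map]
    rfl
  set u : ℂ := (-1) ^ (n - 1) * ∏ k, z k with hu
  have hu1 : ‖u‖ = 1 := by simp [hu, norm_prod, hz]
  have hu0 : u ≠ 0 := norm_ne_zero_iff.mp (by rw [hu1]; exact one_ne_zero)
  have hnum : ∀ x, (blaschkeNum u⁻¹ a).eval x = u⁻¹ * (p.eval x / c) := by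
    intro x
    rw [eval_blaschkeNum, hpe, mul_div_cancel_left₀ _ hc0]
  have hden : ∀ j, (blaschkeDen a).eval (z j) = (blaschkeNum u⁻¹ a).eval (z j) := by
    intro j
    have h1 := eval_blaschkeNum_of_norm_eq_one u⁻¹ a (hz j)
    have h2 : p.eval (z j) = u * (z j ^ n * conj (p.eval (z j))) :=
      eval_herglotzNum_node_eq_conj hz t j
    have h3 : p.eval (z j) = c * (z j ^ n * conj ((blaschkeDen a).eval (z j))) := by
      have h4 := hnum (z j)
      rw [h1, mul_assoc] at h4
      have h5 := mul_left_cancel₀ (inv_ne_zero hu0) h4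
      rw [h5, mul_div_cancel₀ _ hc0]
    have hzn : z j ^ n * conj (z j) ^ n = 1 := by
      rw [← mul_pow, Complex.mul_conj', hz j]; simp
    have h4 : z j ^ n * conj (p.eval (z j)) = c * (blaschkeDen a).eval (z j) := by
      rw [h3, map_mul, map_mul, map_pow, Complex.conj_conj, Complex.conj_ofReal]
      linear_combination (c : ℂ) * (blaschkeDen a).eval (z j) * hzn
    rw [hnum, h2, h4]
    field_simp
  refine ⟨u⁻¹, a, by rw [norm_inv, hu1, inv_one], ha1, fun j => ?_, ?_⟩
  · rw [blaschke_eq_div, hden, div_self]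
    rw [← hden]
    exact eval_blaschkeDen_ne_zero ha1 (hz j).le
  · rw [deriv_blaschke_zero, blaschkeCritical, wronskian_eq_sum hinj
      (by simpa using natDegree_blaschkeNum_le _ a) (by simpa using natDegree_blaschkeDen_le a)
      fun j => (hden j).symm]
    -- The leading coefficients have absolute values `1` and `∏ |aₖ| < 1`.
    have hr : (blaschkeNum u⁻¹ a - blaschkeDen a).coeff (Fintype.card (Fin n)) ≠ 0 := by
      rw [Fintype.card_fin, coeff_sub, coeff_blaschkeNum, coeff_blaschkeDen]
      intro h
      have h1 := congrArg norm (sub_eq_zero.mp h)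
      rw [norm_inv, hu1, inv_one, norm_prod] at h1
      have h2 : ∏ k, ‖-conj (a k)‖ < 1 := by
        have h3 : ∏ k, ‖-conj (a k)‖ ≤ ‖a ⟨0, hn⟩‖ := by
          rw [← Finset.mul_prod_erase _ _ (Finset.mem_univ ⟨0, hn⟩)]
          simp only [norm_neg, RCLike.norm_conj]
          exact mul_le_of_le_one_right (norm_nonneg _)
            (Finset.prod_le_one (fun k _ => norm_nonneg _) fun k _ => (ha1 k).le)
        exact h3.trans_lt (ha1 _)
      exact h2.ne' h1
    generalize (blaschkeNum u⁻¹ a - blaschkeDen a).coeff (Fintype.card (Fin n)) = r at hr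
    have hterm : ∀ j, (C (r * (blaschkeDen a).eval (z j) *
        (derivative (nodePoly z)).eval (z j)) * lagrangeBasis z j ^ 2).eval 0 =
        (2 * r * u⁻¹ / c * (∏ k, z k) ^ 2) * (t j * (z j)⁻¹) := by
      intro j
      have h1 : (derivative (nodePoly z)).eval (z j) * (lagrangeBasis z j).eval 0 =
          ∏ k ∈ Finset.univ.erase j, -z k := by
        rw [eval_derivative_nodePoly, eval_lagrangeBasis, ← Finset.prod_mul_distrib]
        refine Finset.prod_congr rfl fun k hk => ?_
        rw [mul_div_cancel₀, zero_sub]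
        exact sub_ne_zero.mpr (hinj.ne (Finset.ne_of_mem_erase hk).symm)
      have h2 : (∏ k ∈ Finset.univ.erase j, -z k) ^ 2 = (∏ k ∈ Finset.univ.erase j, z k) ^ 2 := by
        simp [← Finset.prod_pow]
      have h3 : (blaschkeDen a).eval (z j) = u⁻¹ * (2 * t j * z j *
          (derivative (nodePoly z)).eval (z j) / c) := by
        rw [hden, hnum, hp, eval_herglotzNum_node]
      rw [← h1] at h2
      rw [eval_mul, eval_C, eval_pow, h3, ← Finset.mul_prod_erase _ z (Finset.mem_univ j), mul_pow,
        ← h2]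
      have := hz0 j
      field_simp
    rw [eval_finsetSum, Finset.sum_congr rfl fun j _ => hterm j, ← Finset.mul_sum]
    have hz2 : ∏ k, z k ≠ 0 := Finset.prod_ne_zero_iff.mpr fun k _ => hz0 k
    exact mul_ne_zero (mul_ne_zero (div_ne_zero (mul_ne_zero (mul_ne_zero two_ne_zero hr)
      (inv_ne_zero hu0)) hc0) (pow_ne_zero 2 hz2)) hsum

end

theorem theorem2 (n : ℕ) (hn : 0 < n) (z : Fin n → ℂ) (hz : ∀ j, ‖z j‖ = 1)
    (hinj : Function.Injective z) :
    (∃ (χ : ℂ) (a : Fin n → ℂ), IsInterpolatingBlaschke z χ a) ∧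
    ∀ (χ : ℂ) (a : Fin n → ℂ), IsInterpolatingBlaschke z χ a →
      ∃ ζ : Fin (n - 1) → ℂ, (∀ k, ‖ζ k‖ < 1 ∧ ζ k ≠ 0) ∧
        HasFDerivAt (energy ζ) (0 : (Fin n → ℂ) →L[ℝ] ℝ) z ∧
        IsMinOn (energyExt ζ) {w : Fin n → ℂ | ∀ j, ‖w j‖ = 1} z := by
  exact ⟨exists_isInterpolatingBlaschke hn hz hinj,
    fun _ _ hB => hB.exists_energy_critical_isMinOn hn hz hinj⟩
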